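/- Let $H$ be a separable infinite-dimensional (real or complex) Hilbert space. A sequence $(f_i)_{i=1}^\infty$ in $H$ is a frame for $H$ if there are constants $0<A\le B<\infty$ with $A\|x\|^2\le\sum_{i}|\langle x,f_i\rangle|^2\le B\|x\|^2$ for all $x\in H$; it is normalized if $\|f_i\|=1$ for all $i$. A family $(g_j)_{j\in J}$ in $H$ is a Riesz basis for $H$ if its closed linear span is $H$ and there is a constant $M>0$ with $$\frac1M\Big(\sum_{j}|a_j|^2\Big)^{1/2}\le\Big\|\sum_{j}a_jg_j\Big\|\le M\Big(\sum_{j}|a_j|^2\Big)^{1/2}$$ for all finitely supported families of scalars $(a_j)_{j\in J}$. Then there is a normalized frame $(f_i)_{i=1}^\infty$ for $H$ such that: 1. some subsequence $(f_{\sigma(n)})_{n=1}^\infty$, with $\sigma(1)<\sigma(2)<\cdots$, is a Schauder basis for $H$; 2. for no subset $J\subset\mathbb{N}$ is $(f_j)_{j\in J}$ a Riesz basis for $H$; 3. for no subset $J\subset\mathbb{N}$ is $(f_j)_{j\in J}$ an unconditional basis for $H$. -/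

import Mathlib

/-- The family `f` is a frame for the Hilbert space `H`: for some bounds `0 < A` and `B`,
`A ‖x‖² ≤ ∑ |⟨x, f i⟩|² ≤ B ‖x‖²` for all `x`, the series being convergent. -/
def IsHilbertFrame (𝕜 : Type*) {H ι : Type*} [RCLike 𝕜] [NormedAddCommGroup H]
    [InnerProductSpace 𝕜 H] (f : ι → H) : Prop :=
  ∃ A B : ℝ, 0 < A ∧ ∀ x : H,
    Summable (fun i => ‖inner 𝕜 x (f i)‖ ^ 2) ∧
      A * ‖x‖ ^ 2 ≤ ∑' i, ‖inner 𝕜 x (f i)‖ ^ 2 ∧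
      ∑' i, ‖inner 𝕜 x (f i)‖ ^ 2 ≤ B * ‖x‖ ^ 2

/-- The family `f` satisfies the two-sided Riesz inequality with constant `M`
(for all finitely supported scalar families). -/
def HasRieszConstant (𝕜 : Type*) {H ι : Type*} [RCLike 𝕜] [NormedAddCommGroup H]
    [InnerProductSpace 𝕜 H] (f : ι → H) (M : ℝ) : Prop :=
  ∀ (s : Finset ι) (a : ι → 𝕜),
    M⁻¹ * √(∑ i ∈ s, ‖a i‖ ^ 2) ≤ ‖∑ i ∈ s, a i • f i‖ ∧
      ‖∑ i ∈ s, a i • f i‖ ≤ M * √(∑ i ∈ s, ‖a i‖ ^ 2)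

/-- The family `f` is a Riesz basis for `H`: it is a Riesz basis for its closed linear span,
and that span is all of `H`. -/
def IsRieszBasis (𝕜 : Type*) {H ι : Type*} [RCLike 𝕜] [NormedAddCommGroup H]
    [InnerProductSpace 𝕜 H] (f : ι → H) : Prop :=
  (Submodule.span 𝕜 (Set.range f)).topologicalClosure = ⊤ ∧
    ∃ M : ℝ, 0 < M ∧ HasRieszConstant 𝕜 f M

/-! Take an infinite matrix `D` with finite rows and columns, acting on `ℓ²` as an unbounded
operator. Projecting the standard orthonormal basis of `ℓ² ⊕ ℓ²` onto the graph of `D` gives a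
Parseval frame `x k`, `g i` with `g i = ∑ D i k • x k`. The graph vectors `y l = (e l, D e l)` are
biorthogonal to `x`, and `‖∑ a l • y l‖² = ‖a‖² + ‖D a‖²`. So `x` is a Schauder basis once cutting
`D` at any column is harmless, which holds if its lower left corners are bounded in Hilbert–Schmidt
norm (`norm_partialSum_le`).

In `blockMatrix` the entries `1 / (i - j)`, divided by the root of a harmonic sum `h`, keep these
corners bounded, while on a block of size `2 * n + 1` the column sums have squared `ℓ²` norm at
least `(2 * n + 1) * h`. Hence the sum of the `g i` of the block, of squared norm at most `2 * n +
1`, expands in `x` with much larger coefficients: no lower `ℓ²` estimate holds for `x`.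

To treat every subfamily, `spreadMatrix` makes each single coefficient bounded. A total subfamily
omits at most `2 * n + 1` of the `x k` in block `n` (`card_missing_le`), too few to matter, so it
has no lower `ℓ²` bound (`false_of_total_of_lower_bound`). Riesz bases and normalized unconditional
bases have one. -/

open Filter Topology

/-! ### Bases of Hilbert spaces: Hilbert, Schauder, unconditional. -/

/-- A separable infinite-dimensional Hilbert space has a Hilbert basis indexed by `ℕ`. -/
theorem exists_hilbertBasis_nat (𝕜 H : Type*) [RCLike 𝕜] [NormedAddCommGroup H]
    [InnerProductSpace 𝕜 H] [CompleteSpace H] [TopologicalSpace.SeparableSpace H]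
    (hinf : ¬ FiniteDimensional 𝕜 H) : Nonempty (HilbertBasis ℕ 𝕜 H) := by
  obtain ⟨w, b, hb⟩ := exists_hilbertBasis 𝕜 H
  have hon : Orthonormal 𝕜 ((↑) : w → H) := hb ▸ b.orthonormal
  have hcount : w.Countable := by
    refine Set.PairwiseDisjoint.countable_of_isOpen (s := fun x => Metric.ball x (1 / 2)) ?_
      (fun _ _ => Metric.isOpen_ball) (fun x _ => ⟨x, Metric.mem_ball_self (by norm_num)⟩)
    intro x hx y hy hxy
    refine Metric.ball_disjoint_ball ?_
    have h0 : inner 𝕜 x y = 0 := hon.2 (i := ⟨x, hx⟩) (j := ⟨y, hy⟩) (by simpa using hxy)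
    have h1 := norm_sub_sq (𝕜 := 𝕜) x y
    have hx1 : ‖x‖ = 1 := hon.1 ⟨x, hx⟩
    have hy1 : ‖y‖ = 1 := hon.1 ⟨y, hy⟩
    rw [hx1, hy1, h0, map_zero] at h1
    rw [dist_eq_norm]
    nlinarith [norm_nonneg (x - y)]
  have hinfinite : Infinite w := by
    rw [← not_finite_iff_infinite]
    intro hfin
    have := Fintype.ofFinite w
    exact hinf (b.toOrthonormalBasis.toBasis.finiteDimensional_of_finite)
  have : Countable w := hcount.to_subtype
  obtain ⟨e⟩ := nonempty_equiv_of_countable (α := ℕ) (β := w)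
  have hrange : Set.range (b ∘ e) = Set.range b := e.surjective.range_comp b
  exact ⟨HilbertBasis.mk (v := b ∘ e) (b.orthonormal.comp e e.injective)
    (by rw [hrange, b.dense_span])⟩

/-- A total system with a biorthogonal system for which the partial sum operators are uniformly
bounded is a Schauder basis. -/
theorem exists_schauderBasis_of_biorthogonal {𝕜 H : Type*} [RCLike 𝕜] [NormedAddCommGroup H]
    [InnerProductSpace 𝕜 H] [CompleteSpace H] (x y : ℕ → H) (K : ℝ)
    (hbi : ∀ k l, inner 𝕜 (x k) (y l) = if k = l then 1 else 0)
    (htotal : ∀ v, (∀ k, inner 𝕜 (x k) v = 0) → v = 0)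
    (hbound : ∀ n v, ‖∑ k ∈ Finset.range n, inner 𝕜 (x k) v • y k‖ ≤ K * ‖v‖) :
    ∃ b : SchauderBasis 𝕜 H, ∀ n, b n = x n := by
  have hbi' : ∀ k l, inner 𝕜 (y k) (x l) = if k = l then 1 else 0 := fun k l => by
    rw [← inner_conj_symm, hbi]
    split_ifs with h1 h2 h2 <;> simp_all
  set P : ℕ → H → H := fun n v => ∑ k ∈ Finset.range n, inner 𝕜 (y k) v • x k with hP
  have hPsub : ∀ n u v, P n (u - v) = P n u - P n v := fun n u v => by
    simp [hP, inner_sub_right, sub_smul]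
  have hK : 0 ≤ K := by
    have := (norm_nonneg _).trans (hbound 0 (x 0))
    have hx0 : x 0 ≠ 0 := fun h => by simpa [h] using hbi 0 0
    exact nonneg_of_mul_nonneg_left this (norm_pos_iff.2 hx0)
  have hPbound : ∀ n v, ‖P n v‖ ≤ K * ‖v‖ := by
    intro n v
    -- `P n` is the adjoint of the operator in `hbound`, hence has the same bound.
    have h1 : ∀ w, inner 𝕜 (P n v) w =
        inner 𝕜 v (∑ k ∈ Finset.range n, inner 𝕜 (x k) w • y k) := fun w => by
      simp [hP, sum_inner, inner_sum, inner_smul_left, inner_smul_right, mul_comm]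
    have h2 : ‖P n v‖ * ‖P n v‖ ≤ ‖v‖ * (K * ‖P n v‖) := by
      rw [← inner_self_eq_norm_mul_norm (𝕜 := 𝕜), h1]
      exact (RCLike.re_le_norm _).trans
        ((norm_inner_le_norm _ _).trans (by gcongr; exact hbound n _))
    rcases (norm_nonneg (P n v)).eq_or_lt with h | h
    · rw [← h]; positivity
    · nlinarith
  have hdense : (Submodule.span 𝕜 (Set.range x)).topologicalClosure = ⊤ := by
    rw [Submodule.topologicalClosure_eq_top_iff, Submodule.eq_bot_iff]
    intro v hv
    exact htotal v fun k => hv _ (Submodule.subset_span ⟨k, rfl⟩)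
  have hspan : ∀ u ∈ Submodule.span 𝕜 (Set.range x), ∀ᶠ n in atTop, P n u = u := by
    intro u hu
    induction hu using Submodule.span_induction with
    | mem u hu =>
      obtain ⟨l, rfl⟩ := hu
      filter_upwards [eventually_gt_atTop l] with n hn
      simp [hP, hbi', hn]
    | zero => simp [hP]
    | add u v _ _ hu hv =>
      filter_upwards [hu, hv] with n h1 h2
      calc P n (u + v) = P n u + P n v := by
            simp [hP, inner_add_right, add_smul, Finset.sum_add_distrib]
        _ = u + v := by rw [h1, h2]
    | smul c u _ hu =>
      filter_upwards [hu] with n h1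
      calc P n (c • u) = c • P n u := by
            simp [hP, inner_smul_right, mul_smul, Finset.smul_sum]
        _ = c • u := by rw [h1]
  have htend : ∀ v, Tendsto (fun n => P n v) atTop (𝓝 v) := by
    intro v
    rw [Metric.tendsto_atTop]
    intro ε hε
    have hv : v ∈ closure (Submodule.span 𝕜 (Set.range x) : Set H) := by
      rw [← Submodule.topologicalClosure_coe, hdense]; trivial
    obtain ⟨u, hu, huv⟩ := Metric.mem_closure_iff.1 hv (ε / (K + 1)) (by positivity)
    obtain ⟨N, hN⟩ := eventually_atTop.1 (hspan u hu)
    refine ⟨N, fun n hn => ?_⟩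
    have h1 : P n v - v = P n (v - u) - (v - u) := by rw [hPsub, hN n hn]; abel
    rw [dist_eq_norm] at huv ⊢
    rw [h1]
    calc ‖P n (v - u) - (v - u)‖ ≤ K * ‖v - u‖ + ‖v - u‖ :=
          (norm_sub_le _ _).trans (by gcongr; exact hPbound n _)
      _ = (K + 1) * ‖v - u‖ := by ring
      _ < (K + 1) * (ε / (K + 1)) := by gcongr
      _ = ε := by field_simp
  refine ⟨{ basis := x
            coord := fun k => innerSL 𝕜 (y k)
            ortho := fun k l => by simp [hbi', Pi.single_apply]
            expansion := fun v => ?_ }, fun n => rfl⟩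
  rw [HasSum, SummationFilter.conditional_filter_eq_map_range, tendsto_map'_iff]
  exact htend v

/-- For vectors `u j`, some choice of signs makes the norm of the signed sum at least the
square function. -/
theorem exists_subset_sum_norm_sq_le {𝕜 H ι : Type*} [RCLike 𝕜] [NormedAddCommGroup H]
    [InnerProductSpace 𝕜 H] [DecidableEq ι] (u : ι → H) (s : Finset ι) :
    ∃ A ⊆ s, ∑ j ∈ s, ‖u j‖ ^ 2 ≤ ‖∑ j ∈ A, u j - ∑ j ∈ s \ A, u j‖ ^ 2 := by
  induction s using Finset.induction_on with
  | empty => exact ⟨∅, by simp⟩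
  | insert j s hj ih =>
    obtain ⟨A, hA, h⟩ := ih
    have hjA : j ∉ A := fun h => hj (hA h)
    set z := ∑ j ∈ A, u j - ∑ j ∈ s \ A, u j with hz
    -- The average of `‖z + u j‖²` and `‖z - u j‖²` is `‖z‖² + ‖u j‖²`, so one of the two signs
    -- reaches it.
    have hpar := parallelogram_law_with_norm 𝕜 z (u j)
    rw [Finset.sum_insert hj]
    by_cases hc : ‖z‖ ^ 2 + ‖u j‖ ^ 2 ≤ ‖z + u j‖ ^ 2
    · refine ⟨insert j A, Finset.insert_subset_insert _ hA, ?_⟩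
      rw [Finset.sum_insert hjA, Finset.insert_sdiff_insert, Finset.sdiff_insert_of_notMem hj]
      have : u j + ∑ j ∈ A, u j - ∑ j ∈ s \ A, u j = z + u j := by rw [hz]; abel
      rw [this]; linarith
    · refine ⟨A, hA.trans (Finset.subset_insert _ _), ?_⟩
      rw [Finset.insert_sdiff_of_notMem _ hjA, Finset.sum_insert (by simp [hj])]
      have : ∑ j ∈ A, u j - (u j + ∑ j ∈ s \ A, u j) = z - u j := by rw [hz]; abel
      rw [this]; nlinarith

/-- A normalized unconditional basis of a Hilbert space dominates `ℓ²`. -/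
theorem UnconditionalSchauderBasis.exists_lower_bound {𝕜 H ι : Type*} [RCLike 𝕜]
    [NormedAddCommGroup H] [InnerProductSpace 𝕜 H] [CompleteSpace H]
    (b : UnconditionalSchauderBasis ι 𝕜 H) (hb : ∀ j, ‖b j‖ = 1) :
    ∃ δ : ℝ, 0 < δ ∧ ∀ (s : Finset ι) (a : ι → 𝕜),
      δ * ∑ j ∈ s, ‖a j‖ ^ 2 ≤ ‖∑ j ∈ s, a j • b j‖ ^ 2 := by
  classical
  obtain ⟨C, hC⟩ := b.exists_norm_proj_le
  have hC0 : 0 ≤ C := (norm_nonneg _).trans (hC ∅)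
  -- A signed sum is a difference of two coordinate projections, whence `2 * C`; the `+ 1` keeps the
  -- constant positive.
  refine ⟨((2 * C + 1) ^ 2)⁻¹, by positivity, fun s a => ?_⟩
  obtain ⟨A, hA, h⟩ := exists_subset_sum_norm_sq_le (𝕜 := 𝕜) (fun j => a j • b j) s
  set y := ∑ j ∈ s, a j • b j with hy
  have hproj : ∀ B ⊆ s, ∑ j ∈ B, a j • b j = b.proj B y := by
    intro B hB
    rw [hy, map_sum]
    simp only [map_smul, b.proj_apply_basis_mem, smul_ite, smul_zero]
    rw [← Finset.sum_filter, Finset.filter_mem_eq_inter, Finset.inter_eq_right.2 hB]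
  have hbd : ∀ B, ‖b.proj B y‖ ≤ C * ‖y‖ := fun B =>
    (b.proj B).le_of_opNorm_le (hC B) y
  rw [inv_mul_le_iff₀ (by positivity)]
  calc ∑ j ∈ s, ‖a j‖ ^ 2 = ∑ j ∈ s, ‖a j • b j‖ ^ 2 := by simp [norm_smul, hb]
    _ ≤ _ := h
    _ ≤ ((2 * C + 1) * ‖y‖) ^ 2 := by
      rw [hproj A hA, hproj _ Finset.sdiff_subset]
      gcongr
      refine (norm_sub_le _ _).trans ?_
      nlinarith [hbd A, hbd (s \ A), norm_nonneg y]
    _ = _ := by ring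

/-- The span of an unconditional basis is dense. -/
theorem UnconditionalSchauderBasis.topologicalClosure_span {𝕜 H ι : Type*} [RCLike 𝕜]
    [NormedAddCommGroup H] [InnerProductSpace 𝕜 H] (b : UnconditionalSchauderBasis ι 𝕜 H) :
    (Submodule.span 𝕜 (Set.range b)).topologicalClosure = ⊤ := by
  rw [eq_top_iff]
  intro v _
  refine mem_closure_of_tendsto (b.expansion v) (Eventually.of_forall fun s => ?_)
  exact sum_mem fun j _ => Submodule.smul_mem _ _ (Submodule.subset_span ⟨j, rfl⟩)

/-! ### Parseval frames from the graph of a matrix. -/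

/-- The vectors `x k`, `g i` form a Parseval frame with relations `g i = ∑ D i k • x k`, and `y` is
biorthogonal to `x`. -/
structure IsGraphSystem (𝕜 : Type*) {H : Type*} [RCLike 𝕜] [NormedAddCommGroup H]
    [InnerProductSpace 𝕜 H] (D : ℕ → ℕ → ℝ) (x g y : ℕ → H) : Prop where
  biorthogonal : ∀ k l, inner 𝕜 (x k) (y l) = if k = l then 1 else 0
  relation : ∀ i N, (∀ k, N ≤ k → D i k = 0) → g i = ∑ k ∈ Finset.range N, (D i k : 𝕜) • x k
  parseval : ∀ v, HasSum (fun s => ‖inner 𝕜 (Sum.elim x g s) v‖ ^ 2) (‖v‖ ^ 2)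

/-- Every matrix with finitely supported rows and columns has a graph system. -/
theorem exists_isGraphSystem (𝕜 H : Type*) [RCLike 𝕜] [NormedAddCommGroup H]
    [InnerProductSpace 𝕜 H] [CompleteSpace H] [TopologicalSpace.SeparableSpace H]
    (hinf : ¬ FiniteDimensional 𝕜 H) (D : ℕ → ℕ → ℝ) (N M : ℕ → ℕ)
    (hN : ∀ i k, N i ≤ k → D i k = 0) (hM : ∀ k i, M k ≤ i → D i k = 0) :
    ∃ x g y : ℕ → H, IsGraphSystem 𝕜 D x g y := by
  obtain ⟨e⟩ := exists_hilbertBasis_nat 𝕜 H hinf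
  let q := Equiv.natSumNatEquivNat
  let b : HilbertBasis (ℕ ⊕ ℕ) 𝕜 H := HilbertBasis.mk (v := e ∘ q)
    (e.orthonormal.comp q q.injective) (by rw [q.surjective.range_comp e, e.dense_span])
  have hb : ∀ s t, inner 𝕜 (b s) (b t) = if s = t then 1 else 0 :=
    orthonormal_iff_ite.1 b.orthonormal
  let ρ : ℕ → H := fun i => b (Sum.inr i) - ∑ k ∈ Finset.range (N i), (D i k : 𝕜) • b (Sum.inl k)
  -- `Γ` is the graph of `D`: orthogonality to `ρ i` says that coordinate `inr i` is row `i` of `D`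
  -- applied to the `inl` coordinates.
  let Γ : Submodule 𝕜 H := (Submodule.span 𝕜 (Set.range ρ))ᗮ
  have hΓ : ∀ v : H, (∀ i, inner 𝕜 (ρ i) v = 0) → v ∈ Γ := by
    intro v hv
    rw [Submodule.mem_orthogonal]
    intro u hu
    induction hu using Submodule.span_induction with
    | mem u hu => obtain ⟨i, rfl⟩ := hu; exact hv i
    | zero => simp
    | add u w _ _ hu hw => rw [inner_add_left, hu, hw, add_zero]
    | smul c u _ hu => rw [inner_smul_left, hu, mul_zero]
  let y₀ : ℕ → H := fun l =>
    b (Sum.inl l) + ∑ i ∈ Finset.range (M l), (D i l : 𝕜) • b (Sum.inr i)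
  have hy₀ : ∀ l, y₀ l ∈ Γ := by
    intro l
    refine hΓ _ fun i => ?_
    have h1 : (if i < M l then (D i l : 𝕜) else 0) = D i l := by
      split_ifs with h
      · rfl
      · rw [hM l i (not_lt.1 h)]; simp
    have h2 : (if l < N i then (D i l : 𝕜) else 0) = D i l := by
      split_ifs with h
      · rfl
      · rw [hN i l (not_lt.1 h)]; simp
    simp [ρ, y₀, inner_sub_left, inner_add_right, sum_inner, inner_sum, inner_smul_left,
      inner_smul_right, hb, h1, h2]
  let yΓ : ℕ → Γ := fun l => ⟨y₀ l, hy₀ l⟩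
  have hbi : ∀ k l, inner 𝕜 (b (Sum.inl k)) (y₀ l) = if k = l then 1 else 0 := by
    intro k l
    simp [y₀, inner_add_right, inner_sum, inner_smul_right, hb]
  have hΓinf : ¬ FiniteDimensional 𝕜 Γ := by
    intro hfin
    have hli : LinearIndependent 𝕜 yΓ := by
      rw [linearIndependent_iff']
      intro s c hc k hk
      have := congrArg (fun v : Γ => inner 𝕜 (b (Sum.inl k)) (v : H)) hc
      simpa [yΓ, inner_sum, inner_smul_right, hbi, hk] using this
    have := hli.finite
    exact not_finite ℕ
  obtain ⟨eΓ⟩ := exists_hilbertBasis_nat 𝕜 Γ hΓinf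
  -- The construction lives in `Γ` and is carried back to `H`.
  let Ψ : Γ ≃ₗᵢ[𝕜] H := eΓ.repr.trans e.repr.symm
  have hinner : ∀ (u : H) (v : H), inner 𝕜 (Ψ (Γ.orthogonalProjectionOnto u)) v =
      inner 𝕜 u (Ψ.symm v : H) := by
    intro u v
    rw [← Submodule.inner_orthogonalProjectionOnto_eq_of_mem_right, ← Ψ.inner_map_map,
      Ψ.apply_symm_apply]
  refine ⟨fun k => Ψ (Γ.orthogonalProjectionOnto (b (Sum.inl k))),
    fun i => Ψ (Γ.orthogonalProjectionOnto (b (Sum.inr i))), fun l => Ψ (yΓ l), ?_, ?_, ?_⟩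
  · intro k l
    rw [hinner, Ψ.symm_apply_apply]
    exact hbi k l
  · intro i n hn
    have h0 : Γ.orthogonalProjectionOnto (ρ i) = 0 := by
      rw [Submodule.orthogonalProjectionOnto_eq_zero_iff]
      exact Submodule.le_orthogonal_orthogonal _ (Submodule.subset_span ⟨i, rfl⟩)
    have hsum : ∑ k ∈ Finset.range (N i), (D i k : 𝕜) • b (Sum.inl k) =
        ∑ k ∈ Finset.range n, (D i k : 𝕜) • b (Sum.inl k) := by
      trans ∑ k ∈ Finset.range (max (N i) n), (D i k : 𝕜) • b (Sum.inl k)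
      · refine Finset.sum_subset (Finset.range_mono (le_max_left _ _)) fun k _ hk => ?_
        rw [hN i k (by simpa using hk)]; simp
      · refine (Finset.sum_subset (Finset.range_mono (le_max_right _ _)) fun k _ hk => ?_).symm
        rw [hn k (by simpa using hk)]; simp
    simp only [ρ, map_sub, sub_eq_zero] at h0
    rw [h0, hsum]
    simp
  · intro v
    have h := b.hasSum_inner_mul_inner (Ψ.symm v : H) (Ψ.symm v : H)
    have h' := RCLike.hasSum_re 𝕜 h
    rw [inner_self_eq_norm_sq, ← Submodule.coe_norm, Ψ.symm.norm_map] at h'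
    convert h' using 2 with s
    have hs : inner 𝕜 (Sum.elim (fun k => Ψ (Γ.orthogonalProjectionOnto (b (Sum.inl k))))
        (fun i => Ψ (Γ.orthogonalProjectionOnto (b (Sum.inr i)))) s) v =
        inner 𝕜 (b s) (Ψ.symm v : H) := by
      rcases s with k | i <;> exact hinner _ _
    rw [hs, ← inner_conj_symm _ (b s), RCLike.conj_mul]
    norm_cast

namespace IsGraphSystem

variable {𝕜 H : Type*} [RCLike 𝕜] [NormedAddCommGroup H] [InnerProductSpace 𝕜 H]
  {D : ℕ → ℕ → ℝ} {x g y : ℕ → H}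

theorem sum_add_sum_le (h : IsGraphSystem 𝕜 D x g y) (A B : Finset ℕ) (v : H) :
    ∑ k ∈ A, ‖inner 𝕜 (x k) v‖ ^ 2 + ∑ i ∈ B, ‖inner 𝕜 (g i) v‖ ^ 2 ≤ ‖v‖ ^ 2 := by
  have := sum_le_hasSum (A.disjSum B) (fun _ _ => by positivity) (h.parseval v)
  simpa [Finset.sum_disjSum] using this

theorem norm_sq_le (h : IsGraphSystem 𝕜 D x g y) (v : H) (c : ℝ)
    (hc : ∀ A B : Finset ℕ,
      ∑ k ∈ A, ‖inner 𝕜 (x k) v‖ ^ 2 + ∑ i ∈ B, ‖inner 𝕜 (g i) v‖ ^ 2 ≤ c) : ‖v‖ ^ 2 ≤ c := by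
  refine hasSum_le_of_sum_le (h.parseval v) fun s => ?_
  rw [← Finset.toLeft_disjSum_toRight (u := s), Finset.sum_disjSum]
  exact hc _ _

/-- Synthesis is adjoint to the isometric analysis map, hence contractive: pair the sum with itself
and use Cauchy–Schwarz. -/
theorem norm_sum_smul_sq_le (h : IsGraphSystem 𝕜 D x g y) (s : Finset (ℕ ⊕ ℕ))
    (a : ℕ ⊕ ℕ → 𝕜) : ‖∑ j ∈ s, a j • Sum.elim x g j‖ ^ 2 ≤ ∑ j ∈ s, ‖a j‖ ^ 2 := by
  set w := ∑ j ∈ s, a j • Sum.elim x g j with hw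
  have h1 : ‖w‖ ^ 2 ≤ ∑ j ∈ s, ‖a j‖ * ‖inner 𝕜 (Sum.elim x g j) w‖ := by
    rw [← inner_self_eq_norm_sq (𝕜 := 𝕜)]
    conv_lhs => enter [2, 2]; rw [hw]
    rw [sum_inner]
    refine (RCLike.re_le_norm _).trans ((norm_sum_le _ _).trans (Finset.sum_le_sum fun j _ => ?_))
    rw [inner_smul_left, norm_mul, RCLike.norm_conj]
  have h2 := Finset.sum_mul_sq_le_sq_mul_sq s (fun j => ‖a j‖)
    (fun j => ‖inner 𝕜 (Sum.elim x g j) w‖)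
  have h3 : ∑ j ∈ s, ‖inner 𝕜 (Sum.elim x g j) w‖ ^ 2 ≤ ‖w‖ ^ 2 :=
    sum_le_hasSum s (fun _ _ => by positivity) (h.parseval w)
  have h4 : (‖w‖ ^ 2) ^ 2 ≤ (∑ j ∈ s, ‖a j‖ ^ 2) * ‖w‖ ^ 2 :=
    (pow_le_pow_left₀ (by positivity) h1 2).trans (h2.trans (by gcongr))
  rcases (sq_nonneg ‖w‖).eq_or_lt with h5 | h5
  · rw [← h5]; positivity
  · nlinarith

theorem norm_le_one (h : IsGraphSystem 𝕜 D x g y) (j : ℕ ⊕ ℕ) : ‖Sum.elim x g j‖ ≤ 1 := by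
  have := h.norm_sum_smul_sq_le {j} (fun _ => 1)
  simp only [Finset.sum_singleton, one_smul, norm_one, one_pow] at this
  exact (sq_le_one_iff₀ (norm_nonneg _)).1 this

theorem inner_relation (h : IsGraphSystem 𝕜 D x g y) (i N : ℕ) (hN : ∀ k, N ≤ k → D i k = 0)
    (v : H) : inner 𝕜 (g i) v = ∑ k ∈ Finset.range N, (D i k : 𝕜) * inner 𝕜 (x k) v := by
  rw [h.relation i N hN, sum_inner]
  simp [inner_smul_left]

theorem inner_x_sum (h : IsGraphSystem 𝕜 D x g y) (s : Finset ℕ) (a : ℕ → 𝕜) (k : ℕ) :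
    inner 𝕜 (x k) (∑ l ∈ s, a l • y l) = if k ∈ s then a k else 0 := by
  simp [inner_sum, inner_smul_right, h.biorthogonal]

theorem inner_g_sum (h : IsGraphSystem 𝕜 D x g y) (s : Finset ℕ) (a : ℕ → 𝕜) (i N : ℕ)
    (hN : ∀ k, N ≤ k → D i k = 0) :
    inner 𝕜 (g i) (∑ l ∈ s, a l • y l) = ∑ l ∈ s, (D i l : 𝕜) * a l := by
  rw [h.inner_relation i N hN]
  simp_rw [h.inner_x_sum, mul_ite, mul_zero]
  rw [← Finset.sum_filter, Finset.filter_mem_eq_inter]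
  refine Finset.sum_subset Finset.inter_subset_right fun k hk hk' => ?_
  rw [hN k (by simpa [hk] using hk')]
  simp

/-- This is the graph norm: the `x` coefficients of the vector are `a` and its `g` coefficients are
`D a`. -/
theorem norm_sq_sum_le (h : IsGraphSystem 𝕜 D x g y) (s : Finset ℕ) (a : ℕ → 𝕜) (N : ℕ → ℕ)
    (hN : ∀ i k, N i ≤ k → D i k = 0) (c : ℝ)
    (hc : ∀ B : Finset ℕ, ∑ i ∈ B, ‖∑ l ∈ s, (D i l : 𝕜) * a l‖ ^ 2 ≤ c) :
    ‖∑ l ∈ s, a l • y l‖ ^ 2 ≤ ∑ l ∈ s, ‖a l‖ ^ 2 + c := by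
  refine h.norm_sq_le _ _ fun A B => add_le_add ?_ ?_
  · simp_rw [h.inner_x_sum]
    calc ∑ k ∈ A, ‖if k ∈ s then a k else 0‖ ^ 2 = ∑ k ∈ A ∩ s, ‖a k‖ ^ 2 := by
          rw [← Finset.filter_mem_eq_inter, Finset.sum_filter]
          exact Finset.sum_congr rfl fun k _ => by split_ifs <;> simp
      _ ≤ _ := Finset.sum_le_sum_of_subset_of_nonneg Finset.inter_subset_right
          fun _ _ _ => by positivity
  · simp_rw [h.inner_g_sum s a _ _ (hN _)]
    exact hc B

/-- The partial sum operators of the biorthogonal system are uniformly bounded if, for a suitable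
splitting of the rows at every `n`, the corner of `D` has bounded Hilbert–Schmidt norm. -/
theorem norm_partialSum_le (h : IsGraphSystem 𝕜 D x g y) (N : ℕ → ℕ)
    (hN : ∀ i k, N i ≤ k → D i k = 0) (n q : ℕ) (hq : ∀ i < q, ∀ k, n ≤ k → D i k = 0)
    (c : ℝ) (hc : ∀ B : Finset ℕ, (∀ i ∈ B, q ≤ i) →
      ∑ i ∈ B, ∑ k ∈ Finset.range n, D i k ^ 2 ≤ c) (v : H) :
    ‖∑ k ∈ Finset.range n, inner 𝕜 (x k) v • y k‖ ≤ √(2 + c) * ‖v‖ := by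
  have hc0 : 0 ≤ c := by simpa using hc ∅ (by simp)
  have hx : ∑ k ∈ Finset.range n, ‖inner 𝕜 (x k) v‖ ^ 2 ≤ ‖v‖ ^ 2 := by
    simpa using h.sum_add_sum_le (Finset.range n) ∅ v
  have key := h.norm_sq_sum_le (Finset.range n) (fun k => inner 𝕜 (x k) v) N hN
    (‖v‖ ^ 2 + c * ‖v‖ ^ 2) (fun B => by
      -- Rows below `q` do not see the truncation at `n`, so they give `inner (g i) v`, controlled
      -- by Bessel. The other rows form the corner.
      rw [← Finset.sum_filter_add_sum_filter_not B (fun i => i < q)]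
      refine add_le_add ?_ ?_
      · have h1 := h.sum_add_sum_le ∅ (B.filter (fun i => i < q)) v
        rw [Finset.sum_empty, zero_add] at h1
        refine le_trans (le_of_eq (Finset.sum_congr rfl fun i hi => ?_)) h1
        rw [h.inner_relation i n (hq i (Finset.mem_filter.1 hi).2)]
      · have h2 := hc (B.filter (fun i => ¬ i < q)) (by simp)
        refine le_trans ?_ (mul_le_mul_of_nonneg_right h2 (sq_nonneg ‖v‖))
        rw [Finset.sum_mul]
        refine Finset.sum_le_sum fun i _ => ?_
        calc ‖∑ l ∈ Finset.range n, (D i l : 𝕜) * inner 𝕜 (x l) v‖ ^ 2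
            ≤ (∑ l ∈ Finset.range n, |D i l| * ‖inner 𝕜 (x l) v‖) ^ 2 := by
              gcongr
              refine (norm_sum_le _ _).trans (Finset.sum_le_sum fun l _ => ?_)
              rw [norm_mul, RCLike.norm_ofReal]
          _ ≤ (∑ l ∈ Finset.range n, |D i l| ^ 2) *
                ∑ l ∈ Finset.range n, ‖inner 𝕜 (x l) v‖ ^ 2 :=
              Finset.sum_mul_sq_le_sq_mul_sq _ _ _
          _ ≤ _ := by
              simp_rw [sq_abs]
              gcongr)
  refine abs_le_of_sq_le_sq' ?_ (by positivity) |>.2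
  rw [mul_pow, Real.sq_sqrt (by positivity)]
  linarith

theorem half_le_norm_of_inner_eq_one {u v : H} (huv : inner 𝕜 u v = 1) (hv : ‖v‖ ^ 2 ≤ 4) :
    1 / 2 ≤ ‖u‖ := by
  have h1 := norm_inner_le_norm (𝕜 := 𝕜) u v
  rw [huv, norm_one] at h1
  have h2 : ‖v‖ ≤ 2 := by nlinarith [norm_nonneg v]
  nlinarith [norm_nonneg u]

end IsGraphSystem

/-! ### Estimates for the block matrix and its spread version. -/

theorem Finset.sum_le_sum_of_nonneg_of_ne_zero {ι : Type*} {f : ι → ℝ} {s t : Finset ι}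
    (hf : ∀ i, 0 ≤ f i) (h : ∀ i ∈ s, f i ≠ 0 → i ∈ t) : ∑ i ∈ s, f i ≤ ∑ i ∈ t, f i := by
  rw [← Finset.sum_filter_ne_zero]
  refine Finset.sum_le_sum_of_subset_of_nonneg (fun i hi => ?_) fun i _ _ => hf i
  rw [Finset.mem_filter] at hi
  exact h i hi.1 hi.2

/-- The harmonic sum attached to the block `[n², (n+1)²)`. -/
noncomputable def blockHarmonic (n : ℕ) : ℝ := ∑ m ∈ Finset.range (2 * n), 1 / ((m : ℝ) + 1)

/-- The lower triangular block diagonal matrix with unit diagonal whose entries in the `n`-th block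
`[n², (n+1)²)` are `1 / (i - j)`, scaled by the root of the harmonic sum. -/
noncomputable def blockMatrix (i j : ℕ) : ℝ :=
  if i = j then 1
  else if j < i ∧ i.sqrt = j.sqrt then 1 / (((i : ℝ) - j) * √(blockHarmonic i.sqrt)) else 0

/-- The matrix obtained from `blockMatrix` by spreading the `j`-th column isometrically over the
`2 * j + 1` columns in `[j², (j+1)²)`. -/
noncomputable def spreadMatrix (i k : ℕ) : ℝ := blockMatrix i k.sqrt / √(2 * (k.sqrt : ℝ) + 1)

theorem one_le_blockHarmonic {n : ℕ} (hn : 1 ≤ n) : 1 ≤ blockHarmonic n := by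
  have : ∑ m ∈ Finset.range 1, 1 / ((m : ℝ) + 1) ≤ blockHarmonic n :=
    Finset.sum_le_sum_of_subset_of_nonneg (Finset.range_mono (by omega))
      fun _ _ _ => by positivity
  simpa using this

theorem tendsto_blockHarmonic : Tendsto blockHarmonic atTop atTop :=
  Real.tendsto_sum_range_one_div_nat_succ_atTop.comp
    (tendsto_id.const_mul_atTop' (by norm_num : 0 < 2))

theorem blockMatrix_self (i : ℕ) : blockMatrix i i = 1 := by simp [blockMatrix]

theorem blockMatrix_nonneg (i j : ℕ) : 0 ≤ blockMatrix i j := by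
  unfold blockMatrix
  split_ifs with h1 h2
  · norm_num
  · have : (j : ℝ) ≤ i := by exact_mod_cast h2.1.le
    have : 0 ≤ (i : ℝ) - j := by linarith
    positivity
  · rfl

theorem blockMatrix_of_lt {i j : ℕ} (h : i < j) : blockMatrix i j = 0 := by
  simp [blockMatrix, h.ne, h.not_gt]

theorem blockMatrix_of_sqrt_ne {i j : ℕ} (h : i.sqrt ≠ j.sqrt) : blockMatrix i j = 0 := by
  have : i ≠ j := fun h' => h (by rw [h'])
  simp [blockMatrix, this, h]

theorem one_le_sqrt_of_lt {i j : ℕ} (hij : j < i) (h : i.sqrt = j.sqrt) : 1 ≤ i.sqrt := by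
  by_contra h0
  have h1 : i.sqrt = 0 := by omega
  have := Nat.sqrt_eq_zero.1 h1
  omega

theorem blockMatrix_le_one (i j : ℕ) : blockMatrix i j ≤ 1 := by
  unfold blockMatrix
  split_ifs with h1 h2
  · rfl
  · have h3 : 1 ≤ √(blockHarmonic i.sqrt) :=
      Real.one_le_sqrt.2 (one_le_blockHarmonic (one_le_sqrt_of_lt h2.1 h2.2))
    have h4 : (1 : ℝ) ≤ (i : ℝ) - j := by
      have : (j : ℝ) + 1 ≤ i := by exact_mod_cast h2.1
      linarith
    rw [div_le_one (by positivity)]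
    nlinarith
  · norm_num

/-- The tail of `∑ 1 / m²` decays like `1 / m`, so summing over the rows of a corner leaves a
harmonic sum, which the normalization of `blockMatrix` cancels. -/
theorem sum_one_div_sub_sq_le (i q : ℕ) (hq : q ≤ i) :
    ∑ j ∈ Finset.range q, 1 / ((i : ℝ) - j) ^ 2 ≤ 2 / ((i : ℝ) - q + 1) := by
  induction q with
  | zero => simp; positivity
  | succ q ih =>
    rw [Finset.sum_range_succ]
    have ht : (1 : ℝ) ≤ (i : ℝ) - q := by
      have : (q : ℝ) + 1 ≤ i := by exact_mod_cast hq
      linarith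
    refine (add_le_add_left (ih (by omega)) _).trans ?_
    push_cast
    rw [show (i : ℝ) - (q + 1) + 1 = i - q by ring]
    generalize (i : ℝ) - q = t at ht
    rw [div_add_div _ _ (by positivity) (by positivity), div_le_div_iff₀ (by positivity)
      (by positivity)]
    nlinarith [mul_nonneg (by positivity : (0 : ℝ) ≤ t) (sub_nonneg.2 ht)]

/-- The corners of `blockMatrix` below and to the left of the diagonal are uniformly bounded in
Hilbert–Schmidt norm. -/
theorem sum_corner_blockMatrix_sq_le (q : ℕ) (B : Finset ℕ) (hB : ∀ i ∈ B, q ≤ i) :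
    ∑ i ∈ B, ∑ j ∈ Finset.range q, blockMatrix i j ^ 2 ≤ 2 := by
  set n := q.sqrt with hn
  have hzero : ∀ i j, q ≤ i → j < q → ¬ (i < (n + 1) * (n + 1) ∧ n * n < q) →
      blockMatrix i j = 0 := by
    intro i j hi hj h
    refine blockMatrix_of_sqrt_ne fun hs => h ?_
    have h1 : n ≤ i.sqrt := Nat.sqrt_le_sqrt hi
    have h2 : j.sqrt ≤ n := Nat.sqrt_le_sqrt hj.le
    have h3 : i.sqrt = n := by omega
    have h4 : j.sqrt = n := by omega
    exact ⟨Nat.sqrt_lt.1 (by omega), (Nat.le_sqrt.1 h4.ge).trans_lt hj⟩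
  -- Otherwise `q = n * n`, the cut falls between two blocks and the corner vanishes.
  by_cases hq : n * n < q
  swap
  · rw [Finset.sum_eq_zero fun i hi => Finset.sum_eq_zero fun j hj => ?_]
    · norm_num
    · rw [hzero i j (hB i hi) (Finset.mem_range.1 hj) (fun h => hq h.2)]; norm_num
  have hn1 : 1 ≤ n := by
    by_contra h
    have h0 : q.sqrt = 0 := by omega
    have := Nat.sqrt_eq_zero.1 h0
    omega
  have hh : 0 < blockHarmonic n := by linarith [one_le_blockHarmonic hn1]
  have hrow : ∀ i, q ≤ i → i < (n + 1) * (n + 1) →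
      ∑ j ∈ Finset.range q, blockMatrix i j ^ 2 ≤ 2 / ((i : ℝ) - q + 1) / blockHarmonic n := by
    intro i hi hi'
    refine le_trans ?_ (div_le_div_of_nonneg_right (sum_one_div_sub_sq_le i q hi) hh.le)
    rw [Finset.sum_div]
    refine Finset.sum_le_sum fun j hj => ?_
    have hj := Finset.mem_range.1 hj
    have his : i.sqrt = n := (Nat.eq_sqrt.2 ⟨hq.le.trans hi, hi'⟩).symm
    unfold blockMatrix
    rw [if_neg (by omega), his]
    split_ifs
    · rw [div_pow, mul_pow, Real.sq_sqrt hh.le, div_div, one_pow]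
    · rw [zero_pow two_ne_zero]; positivity
  calc ∑ i ∈ B, ∑ j ∈ Finset.range q, blockMatrix i j ^ 2
      ≤ ∑ i ∈ Finset.Ico q ((n + 1) * (n + 1)), ∑ j ∈ Finset.range q, blockMatrix i j ^ 2 := by
        refine Finset.sum_le_sum_of_nonneg_of_ne_zero
          (fun i => Finset.sum_nonneg fun _ _ => by positivity) fun i hi hne => ?_
        rw [Finset.mem_Ico]
        refine ⟨hB i hi, not_le.1 fun h => hne (Finset.sum_eq_zero fun j hj => ?_)⟩
        rw [hzero i j (hB i hi) (Finset.mem_range.1 hj) (fun h' => by omega)]; norm_num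
    _ ≤ ∑ i ∈ Finset.Ico q ((n + 1) * (n + 1)), 2 / ((i : ℝ) - q + 1) / blockHarmonic n :=
        Finset.sum_le_sum fun i hi => hrow i (Finset.mem_Ico.1 hi).1 (Finset.mem_Ico.1 hi).2
    _ = 2 / blockHarmonic n *
          ∑ m ∈ Finset.range ((n + 1) * (n + 1) - q), 1 / ((m : ℝ) + 1) := by
        rw [Finset.sum_Ico_eq_sum_range, Finset.mul_sum]
        refine Finset.sum_congr rfl fun m _ => ?_
        push_cast
        rw [add_sub_cancel_left]
        field_simp
    _ ≤ 2 / blockHarmonic n * blockHarmonic n := by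
        gcongr
        -- As `n * n < q`, at most `2 * n` rows of the block remain: the number of terms in
        -- `blockHarmonic n`.
        refine Finset.sum_le_sum_of_subset_of_nonneg (Finset.range_mono ?_)
          fun _ _ _ => by positivity
        have : (n + 1) * (n + 1) = n * n + 2 * n + 1 := by ring
        omega
    _ = 2 := by field_simp

theorem sum_col_blockMatrix_sq_le (j : ℕ) (B : Finset ℕ) :
    ∑ i ∈ B, blockMatrix i j ^ 2 ≤ 3 := by
  rw [← Finset.sum_filter_add_sum_filter_not B (fun i => i < j + 1)]
  have h1 : ∑ i ∈ B with i < j + 1, blockMatrix i j ^ 2 ≤ ∑ i ∈ {j}, blockMatrix i j ^ 2 := by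
    refine Finset.sum_le_sum_of_nonneg_of_ne_zero (fun _ => by positivity) fun i hi hne => ?_
    rw [Finset.mem_singleton]
    by_contra h
    have hi := (Finset.mem_filter.1 hi).2
    exact hne (by rw [blockMatrix_of_lt (by omega)]; norm_num)
  have h2 := sum_corner_blockMatrix_sq_le (j + 1) (B.filter fun i => ¬ i < j + 1) (by simp)
  have h3 : ∑ i ∈ B with ¬ i < j + 1, blockMatrix i j ^ 2 ≤
      ∑ i ∈ B with ¬ i < j + 1, ∑ l ∈ Finset.range (j + 1), blockMatrix i l ^ 2 :=
    Finset.sum_le_sum fun i _ => Finset.single_le_sum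
      (f := fun l => blockMatrix i l ^ 2) (fun _ _ => by positivity) (by simp)
  rw [Finset.sum_singleton, blockMatrix_self] at h1
  linarith

/-- Exactly `2 * j + 1` integers have integer square root `j`. -/
theorem sum_sqrt_div_range (φ : ℕ → ℝ) (m : ℕ) :
    ∑ k ∈ Finset.range (m * m), φ k.sqrt / (2 * (k.sqrt : ℝ) + 1) =
      ∑ j ∈ Finset.range m, φ j := by
  induction m with
  | zero => simp
  | succ m ih =>
    rw [Finset.sum_range_succ, ← ih, show (m + 1) * (m + 1) = m * m + (2 * m + 1) by ring,
      Finset.sum_range_add]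
    congr 1
    have : ∀ t ∈ Finset.range (2 * m + 1),
        φ (m * m + t).sqrt / (2 * ((m * m + t).sqrt : ℝ) + 1) = φ m / (2 * (m : ℝ) + 1) := by
      intro t ht
      have ht := Finset.mem_range.1 ht
      rw [Nat.sqrt_add_eq m (by omega)]
    rw [Finset.sum_congr rfl this]
    simp
    field_simp

theorem sum_sqrt_div_Ico (φ : ℕ → ℝ) {l m : ℕ} (h : l ≤ m) :
    ∑ k ∈ Finset.Ico (l * l) (m * m), φ k.sqrt / (2 * (k.sqrt : ℝ) + 1) =
      ∑ j ∈ Finset.Ico l m, φ j := by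
  rw [Finset.sum_Ico_eq_sub _ (Nat.mul_le_mul h h), Finset.sum_Ico_eq_sub _ h,
    sum_sqrt_div_range, sum_sqrt_div_range]

theorem spreadMatrix_sq (i k : ℕ) :
    spreadMatrix i k ^ 2 = blockMatrix i k.sqrt ^ 2 / (2 * (k.sqrt : ℝ) + 1) := by
  rw [spreadMatrix, div_pow, Real.sq_sqrt (by positivity)]

theorem spreadMatrix_of_lt_sqrt {i k : ℕ} (h : i < k.sqrt) : spreadMatrix i k = 0 := by
  rw [spreadMatrix, blockMatrix_of_lt h, zero_div]

theorem spreadMatrix_of_sqrt_ne {i k : ℕ} (h : i.sqrt ≠ k.sqrt.sqrt) : spreadMatrix i k = 0 := by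
  rw [spreadMatrix, blockMatrix_of_sqrt_ne h, zero_div]

theorem spreadMatrix_row_finite (i k : ℕ) (h : (i + 1) * (i + 1) ≤ k) : spreadMatrix i k = 0 :=
  spreadMatrix_of_lt_sqrt (Nat.le_sqrt.2 h)

theorem spreadMatrix_col_finite (k i : ℕ)
    (h : (k.sqrt.sqrt + 1) * (k.sqrt.sqrt + 1) ≤ i) : spreadMatrix i k = 0 :=
  spreadMatrix_of_sqrt_ne (by have := Nat.le_sqrt.2 h; omega)

/-- The cut `n` may split the group of column `n.sqrt`. The whole groups cost the corner bound 2,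
the split one at most a full column, 3. -/
theorem sum_corner_spreadMatrix_sq_le (n : ℕ) (B : Finset ℕ) (hB : ∀ i ∈ B, n.sqrt ≤ i) :
    ∑ i ∈ B, ∑ k ∈ Finset.range n, spreadMatrix i k ^ 2 ≤ 5 := by
  have h1 : ∀ i ∈ B, ∑ k ∈ Finset.range n, spreadMatrix i k ^ 2 ≤
      ∑ j ∈ Finset.range n.sqrt, blockMatrix i j ^ 2 + blockMatrix i n.sqrt ^ 2 := by
    intro i _
    rw [← Finset.sum_range_succ (fun j => blockMatrix i j ^ 2),
      ← sum_sqrt_div_range (fun j => blockMatrix i j ^ 2)]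
    simp_rw [spreadMatrix_sq]
    exact Finset.sum_le_sum_of_subset_of_nonneg
      (Finset.range_mono (Nat.lt_succ_sqrt n).le) fun _ _ _ => by positivity
  refine (Finset.sum_le_sum h1).trans ?_
  rw [Finset.sum_add_distrib]
  linarith [sum_corner_blockMatrix_sq_le n.sqrt B hB, sum_col_blockMatrix_sq_le n.sqrt B]

theorem sum_col_spreadMatrix_sq_le (k : ℕ) (B : Finset ℕ) :
    ∑ i ∈ B, spreadMatrix i k ^ 2 ≤ 3 := by
  refine le_trans (Finset.sum_le_sum fun i _ => ?_) (sum_col_blockMatrix_sq_le k.sqrt B)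
  rw [spreadMatrix_sq]
  exact div_le_self (by positivity) (by linarith [Nat.cast_nonneg (α := ℝ) k.sqrt])

theorem sum_spreadMatrix_group (i j : ℕ) :
    ∑ k ∈ Finset.Ico (j * j) ((j + 1) * (j + 1)),
      spreadMatrix i k * (√(2 * (j : ℝ) + 1))⁻¹ = blockMatrix i j := by
  have h := sum_sqrt_div_Ico (fun l => blockMatrix i l) (Nat.le_succ j)
  rw [Nat.Ico_succ_singleton, Finset.sum_singleton] at h
  rw [← h]
  refine Finset.sum_congr rfl fun k hk => ?_
  have hk : j = k.sqrt := Nat.eq_sqrt.2 (Finset.mem_Ico.1 hk)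
  subst hk
  rw [spreadMatrix, div_mul_eq_mul_div, ← div_eq_mul_inv, div_div,
    Real.mul_self_sqrt (by positivity)]

theorem sum_harmonic_range (d : ℕ) :
    ∑ p ∈ Finset.range d, ∑ m ∈ Finset.range p, 1 / ((m : ℝ) + 1) =
      d * ∑ m ∈ Finset.range d, 1 / ((m : ℝ) + 1) - d := by
  induction d with
  | zero => simp
  | succ d ih =>
    rw [Finset.sum_range_succ, ih, Finset.sum_range_succ]
    push_cast
    field_simp
    ring

theorem le_sum_row_blockMatrix {n p : ℕ} (hp : p < 2 * n + 1) :
    1 + (∑ m ∈ Finset.range p, 1 / ((m : ℝ) + 1)) / √(blockHarmonic n) ≤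
      ∑ j ∈ Finset.Ico (n * n) ((n + 1) * (n + 1)), blockMatrix (n * n + p) j := by
  have hsub : Finset.Ico (n * n) (n * n + p + 1) ⊆ Finset.Ico (n * n) ((n + 1) * (n + 1)) :=
    Finset.Ico_subset_Ico_right (by ring_nf; omega)
  refine le_trans (le_of_eq ?_)
    (Finset.sum_le_sum_of_subset_of_nonneg hsub fun _ _ _ => blockMatrix_nonneg _ _)
  rw [Finset.sum_Ico_succ_top (by omega), blockMatrix_self, add_comm, Finset.sum_Ico_eq_sum_range,
    Nat.add_sub_cancel_left, ← Finset.sum_range_reflect, Finset.sum_div]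
  congr 1
  refine Finset.sum_congr rfl fun m hm => ?_
  have hm := Finset.mem_range.1 hm
  have h1 : (n * n + p).sqrt = n := Nat.sqrt_add_eq n (by omega)
  have h2 : (n * n + m).sqrt = n := Nat.sqrt_add_eq n (by omega)
  rw [blockMatrix, if_neg (by omega), if_pos ⟨by omega, by rw [h1, h2]⟩, h1, div_div]
  congr 2
  rw [Nat.cast_sub (by omega), Nat.cast_sub (by omega)]
  push_cast
  ring

/-- The column sums of the blocks of `blockMatrix` are large in `ℓ²`. -/
theorem le_sum_colSum_sq {n : ℕ} (hn : 1 ≤ n) :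
    (2 * n + 1) * blockHarmonic n ≤ ∑ j ∈ Finset.Ico (n * n) ((n + 1) * (n + 1)),
      (∑ i ∈ Finset.Ico (n * n) ((n + 1) * (n + 1)), blockMatrix i j) ^ 2 := by
  set G := Finset.Ico (n * n) ((n + 1) * (n + 1)) with hG
  have hcard : (n + 1) * (n + 1) - n * n = 2 * n + 1 := by
    have : (n + 1) * (n + 1) = n * n + (2 * n + 1) := by ring
    omega
  have hGc : (G.card : ℝ) = 2 * n + 1 := by rw [hG, Nat.card_Ico, hcard]; push_cast; ring
  have hh := one_le_blockHarmonic hn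
  have hs : 1 ≤ √(blockHarmonic n) := Real.one_le_sqrt.2 hh
  have hss : √(blockHarmonic n) ^ 2 = blockHarmonic n := Real.sq_sqrt (by linarith)
  have htot : (2 * n + 1) * √(blockHarmonic n) ≤ ∑ j ∈ G, ∑ i ∈ G, blockMatrix i j := by
    -- By rows, with `d = 2 * n + 1` and `h = blockHarmonic n`, the total is at least `d + (d * h -
    -- d) / √h ≥ d * √h`. Cauchy–Schwarz over the `d` columns then gives the claim.
    rw [Finset.sum_comm]
    conv_rhs => rw [hG, Finset.sum_Ico_eq_sum_range, hcard]
    refine le_trans ?_ (Finset.sum_le_sum fun p hp =>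
      le_sum_row_blockMatrix (Finset.mem_range.1 hp))
    rw [Finset.sum_add_distrib, ← Finset.sum_div, sum_harmonic_range]
    have h1 : blockHarmonic n ≤ ∑ m ∈ Finset.range (2 * n + 1), 1 / ((m : ℝ) + 1) :=
      Finset.sum_le_sum_of_subset_of_nonneg (Finset.range_mono (by omega))
        fun _ _ _ => by positivity
    simp only [Finset.sum_const, Finset.card_range, nsmul_eq_mul, mul_one]
    push_cast
    rw [← sub_le_iff_le_add', le_div_iff₀ (by positivity)]
    have hd : (0 : ℝ) ≤ 2 * n + 1 := by positivity
    nlinarith [mul_le_mul_of_nonneg_left h1 hd, mul_nonneg hd (sub_nonneg.2 hs)]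
  have hcs := sq_sum_le_card_mul_sum_sq (s := G) (f := fun j => ∑ i ∈ G, blockMatrix i j)
  rw [hGc] at hcs
  have hd : (0 : ℝ) < 2 * n + 1 := by positivity
  have := pow_le_pow_left₀ (by positivity) htot 2
  rw [mul_pow, hss] at this
  refine le_of_mul_le_mul_left ?_ hd
  nlinarith

theorem sum_colSum_spreadMatrix_sq (n : ℕ) :
    ∑ k ∈ Finset.Ico (n * n * (n * n)) ((n + 1) * (n + 1) * ((n + 1) * (n + 1))),
      (∑ i ∈ Finset.Ico (n * n) ((n + 1) * (n + 1)), spreadMatrix i k) ^ 2 =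
    ∑ j ∈ Finset.Ico (n * n) ((n + 1) * (n + 1)),
      (∑ i ∈ Finset.Ico (n * n) ((n + 1) * (n + 1)), blockMatrix i j) ^ 2 := by
  rw [← sum_sqrt_div_Ico (fun j => (∑ i ∈ Finset.Ico (n * n) ((n + 1) * (n + 1)),
    blockMatrix i j) ^ 2) (Nat.mul_le_mul (Nat.le_succ n) (Nat.le_succ n))]
  refine Finset.sum_congr rfl fun k _ => ?_
  simp_rw [spreadMatrix]
  rw [← Finset.sum_div, div_pow, Real.sq_sqrt (by positivity)]

/-- This is the gain from spreading: a column sum of at most `2 * n + 1` is divided by `√(2 * j +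
1)` with `j ≥ n * n`. -/
theorem colSum_spreadMatrix_sq_le {n k : ℕ} (hk : n * n * (n * n) ≤ k) :
    (∑ i ∈ Finset.Ico (n * n) ((n + 1) * (n + 1)), spreadMatrix i k) ^ 2 ≤ 4 := by
  simp_rw [spreadMatrix]
  rw [← Finset.sum_div, div_pow, Real.sq_sqrt (by positivity), div_le_iff₀ (by positivity)]
  have h1 : ∑ i ∈ Finset.Ico (n * n) ((n + 1) * (n + 1)), blockMatrix i k.sqrt ≤ 2 * n + 1 := by
    refine (Finset.sum_le_sum fun i _ => blockMatrix_le_one i _).trans (le_of_eq ?_)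
    have : (n + 1) * (n + 1) - n * n = 2 * n + 1 := by
      have : (n + 1) * (n + 1) = n * n + (2 * n + 1) := by ring
      omega
    simp [this]
  have h0 : 0 ≤ ∑ i ∈ Finset.Ico (n * n) ((n + 1) * (n + 1)), blockMatrix i k.sqrt :=
    Finset.sum_nonneg fun i _ => blockMatrix_nonneg i _
  have h2 : (n : ℝ) * n ≤ k.sqrt := by exact_mod_cast Nat.le_sqrt.2 hk
  have h3 := pow_le_pow_left₀ h0 h1 2
  nlinarith [sq_nonneg ((n : ℝ) - 1)]

/-! ### The graph system of `spreadMatrix`. -/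

namespace IsGraphSystem

variable {𝕜 H : Type*} [RCLike 𝕜] [NormedAddCommGroup H] [InnerProductSpace 𝕜 H]
  {x g y : ℕ → H}

/-- Each vector pairs to 1 with a vector of squared norm at most `1 + 3`. For `x k` this is `y k`;
for `g j` it is the normalized sum of `y` over the group of column `j`, which `D` sends to column
`j` of `blockMatrix`. -/
theorem half_le_norm (h : IsGraphSystem 𝕜 spreadMatrix x g y) (j : ℕ ⊕ ℕ) :
    1 / 2 ≤ ‖Sum.elim x g j‖ := by
  rcases j with k | j
  · refine half_le_norm_of_inner_eq_one (𝕜 := 𝕜) (v := ∑ l ∈ {k}, (1 : 𝕜) • y l) ?_ ?_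
    · simp [h.biorthogonal]
    · refine (h.norm_sq_sum_le {k} (fun _ => 1) _ spreadMatrix_row_finite 3 fun B => ?_).trans ?_
      · simpa using sum_col_spreadMatrix_sq_le k B
      · norm_num
  · let I := Finset.Ico (j * j) ((j + 1) * (j + 1))
    let r : 𝕜 := (((√(2 * (j : ℝ) + 1))⁻¹ : ℝ) : 𝕜)
    have hI : I.card = 2 * j + 1 := by
      have : (j + 1) * (j + 1) = j * j + (2 * j + 1) := by ring
      simp only [I, Nat.card_Ico]
      omega
    have hD : ∀ i, ∑ l ∈ I, (spreadMatrix i l : 𝕜) * r = blockMatrix i j := by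
      intro i
      rw [← sum_spreadMatrix_group i j]
      push_cast
      simp [r, I]
    have hr : ∑ l ∈ I, ‖r‖ ^ 2 = 1 := by
      have h0 : (0 : ℝ) < 2 * j + 1 := by positivity
      rw [Finset.sum_const, hI, RCLike.norm_ofReal, sq_abs, inv_pow, Real.sq_sqrt h0.le]
      simp only [nsmul_eq_mul]
      push_cast
      field_simp
    refine half_le_norm_of_inner_eq_one (𝕜 := 𝕜) (v := ∑ l ∈ I, r • y l) ?_ ?_
    · rw [Sum.elim_inr, h.inner_g_sum I (fun _ => r) j _ (spreadMatrix_row_finite j), hD,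
        blockMatrix_self, RCLike.ofReal_one]
    · refine (h.norm_sq_sum_le I (fun _ => r) _ spreadMatrix_row_finite 3 fun B => ?_).trans ?_
      · simp_rw [hD, RCLike.norm_ofReal, sq_abs]
        exact sum_col_blockMatrix_sq_le j B
      · rw [hr]; norm_num

theorem eq_zero_of_forall_inner_eq_zero (h : IsGraphSystem 𝕜 spreadMatrix x g y) (v : H)
    (hv : ∀ k, inner 𝕜 (x k) v = 0) : v = 0 := by
  have : ‖v‖ ^ 2 ≤ 0 := h.norm_sq_le v 0 fun A B => by
    simp [hv, h.inner_relation _ _ (spreadMatrix_row_finite _)]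
  exact norm_eq_zero.1 (pow_eq_zero_iff two_ne_zero |>.1 (le_antisymm this (sq_nonneg _)))

theorem exists_schauderBasis [CompleteSpace H] (h : IsGraphSystem 𝕜 spreadMatrix x g y) :
    ∃ b : SchauderBasis 𝕜 H, ∀ n, b n = ((‖x n‖⁻¹ : ℝ) : 𝕜) • x n := by
  have hne : ∀ k, ((‖x k‖ : ℝ) : 𝕜) ≠ 0 := fun k => by
    have := h.half_le_norm (Sum.inl k)
    rw [Sum.elim_inl] at this
    exact RCLike.ofReal_ne_zero.2 (by linarith)
  refine exists_schauderBasis_of_biorthogonal (fun n => ((‖x n‖⁻¹ : ℝ) : 𝕜) • x n)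
    (fun n => ((‖x n‖ : ℝ) : 𝕜) • y n) (√(2 + 5)) ?_ ?_ ?_
  · intro k l
    rw [inner_smul_left, inner_smul_right, h.biorthogonal]
    split_ifs with hkl
    · subst hkl
      simp [hne k]
    · simp
  · intro v hv
    refine h.eq_zero_of_forall_inner_eq_zero v fun k => ?_
    have := hv k
    rw [inner_smul_left] at this
    refine (mul_eq_zero.1 this).resolve_left ?_
    simpa using hne k
  · intro n v
    have := h.norm_partialSum_le _ spreadMatrix_row_finite n n.sqrt
      (fun i hi k hk => spreadMatrix_of_lt_sqrt (hi.trans_le (Nat.sqrt_le_sqrt hk))) 5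
      (sum_corner_spreadMatrix_sq_le n) v
    refine le_trans (le_of_eq (congrArg _ (Finset.sum_congr rfl fun k _ => ?_))) this
    rw [inner_smul_left, smul_smul]
    congr 1
    have := hne k
    simp only [map_inv₀, RCLike.conj_ofReal]
    field_simp

theorem isHilbertFrame_normalized (h : IsGraphSystem 𝕜 spreadMatrix x g y) :
    IsHilbertFrame 𝕜 (fun j => ((‖Sum.elim x g j‖⁻¹ : ℝ) : 𝕜) • Sum.elim x g j) := by
  refine ⟨1, 4, one_pos, fun v => ?_⟩
  have hp := h.parseval v
  have hterm : ∀ j, ‖inner 𝕜 v (((‖Sum.elim x g j‖⁻¹ : ℝ) : 𝕜) • Sum.elim x g j)‖ ^ 2 =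
      (‖Sum.elim x g j‖ ^ 2)⁻¹ * ‖inner 𝕜 (Sum.elim x g j) v‖ ^ 2 := fun j => by
    rw [inner_smul_right, norm_mul, RCLike.norm_ofReal, mul_pow, sq_abs, inv_pow,
      norm_inner_symm]
  simp_rw [hterm]
  have hsq : ∀ j, 1 ≤ (‖Sum.elim x g j‖ ^ 2)⁻¹ ∧ (‖Sum.elim x g j‖ ^ 2)⁻¹ ≤ 4 := fun j => by
    have h1 := h.half_le_norm j
    have h2 := h.norm_le_one j
    have h3 : 1 / 4 ≤ ‖Sum.elim x g j‖ ^ 2 := by nlinarith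
    have h4 : ‖Sum.elim x g j‖ ^ 2 ≤ 1 := by nlinarith
    refine ⟨(one_le_inv₀ (by linarith)).2 h4, inv_le_of_inv_le₀ (by norm_num) (by linarith)⟩
  have hle : ∀ j, (‖Sum.elim x g j‖ ^ 2)⁻¹ * ‖inner 𝕜 (Sum.elim x g j) v‖ ^ 2 ≤
      4 * ‖inner 𝕜 (Sum.elim x g j) v‖ ^ 2 := fun j =>
    mul_le_mul_of_nonneg_right (hsq j).2 (by positivity)
  have hs := Summable.of_nonneg_of_le (fun j => by positivity) hle (hp.summable.mul_left 4)
  refine ⟨hs, ?_, ?_⟩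
  · rw [one_mul, ← hp.tsum_eq]
    exact hp.summable.tsum_le_tsum
      (fun j => le_mul_of_one_le_left (by positivity) (hsq j).1) hs
  · rw [← hp.tsum_eq, ← tsum_mul_left]
    exact hs.tsum_le_tsum hle (hp.summable.mul_left 4)

theorem sqrt_sqrt_eq_iff {n k : ℕ} : k.sqrt.sqrt = n ↔
    k ∈ Finset.Ico (n * n * (n * n)) ((n + 1) * (n + 1) * ((n + 1) * (n + 1))) := by
  rw [eq_comm, Nat.eq_sqrt, Nat.le_sqrt, Nat.sqrt_lt, Finset.mem_Ico]

/-- A total subfamily contains all but `2 * n + 1` of the vectors `x k` of the `n`-th block. -/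
theorem card_missing_le (h : IsGraphSystem 𝕜 spreadMatrix x g y) (J : Set (ℕ ⊕ ℕ))
    [DecidablePred (· ∈ J)]
    (htotal : ∀ v, (∀ j ∈ J, inner 𝕜 (Sum.elim x g j) v = 0) → v = 0) (n : ℕ) :
    ((Finset.Ico (n * n * (n * n)) ((n + 1) * (n + 1) * ((n + 1) * (n + 1)))).filter
      fun k => Sum.inl k ∉ J).card ≤ 2 * n + 1 := by
  set E := Finset.Ico (n * n * (n * n)) ((n + 1) * (n + 1) * ((n + 1) * (n + 1))) with hE
  set G := Finset.Ico (n * n) ((n + 1) * (n + 1)) with hG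
  have hGcard : G.card = 2 * n + 1 := by
    have : (n + 1) * (n + 1) = n * n + (2 * n + 1) := by ring
    rw [hG, Nat.card_Ico]
    omega
  let S : Finset (ℕ ⊕ ℕ) := ((E.filter fun k => Sum.inl k ∈ J)).disjSum G
  -- Vectors in the span of `y` over `E` are orthogonal to all `x` and `g` outside the block, so
  -- totality makes testing against `S` injective. Comparing dimensions bounds the missing indices
  -- by `G.card`.
  let T : (E → 𝕜) →ₗ[𝕜] (S → 𝕜) := LinearMap.pi fun s =>
    (innerₛₗ 𝕜 (Sum.elim x g (s : ℕ ⊕ ℕ))) ∘ₗ Fintype.linearCombination 𝕜 (fun k : E => y k)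
  have hT : Function.Injective T := by
    rw [← LinearMap.ker_eq_bot, LinearMap.ker_eq_bot']
    intro a ha
    set v := ∑ k : E, a k • y k with hv
    have hTa : ∀ s ∈ S, inner 𝕜 (Sum.elim x g s) v = 0 := fun s hs => by
      simpa [T, Fintype.linearCombination_apply, hv] using congrFun ha ⟨s, hs⟩
    have hx : ∀ k (hk : k ∈ E), inner 𝕜 (x k) v = a ⟨k, hk⟩ := by
      intro k hk
      rw [hv, inner_sum, Finset.sum_eq_single ⟨k, hk⟩]
      · rw [inner_smul_right, h.biorthogonal, if_pos rfl, mul_one]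
      · intro l _ hl
        rw [inner_smul_right, h.biorthogonal, if_neg, mul_zero]
        exact fun h' => hl (Subtype.ext h'.symm)
      · simp
    have hx' : ∀ k ∉ E, inner 𝕜 (x k) v = 0 := by
      intro k hk
      rw [hv, inner_sum]
      refine Finset.sum_eq_zero fun l _ => ?_
      rw [inner_smul_right, h.biorthogonal, if_neg, mul_zero]
      rintro rfl
      exact hk l.2
    have hv0 : v = 0 := by
      refine htotal v fun j hj => ?_
      rcases j with k | i
      · by_cases hk : k ∈ E
        · exact hTa _ (Finset.inl_mem_disjSum.2 (Finset.mem_filter.2 ⟨hk, hj⟩))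
        · exact hx' k hk
      · by_cases hi : i ∈ G
        · exact hTa _ (Finset.inr_mem_disjSum.2 hi)
        · rw [Sum.elim_inr, h.inner_relation i _ (spreadMatrix_row_finite i)]
          refine Finset.sum_eq_zero fun k _ => ?_
          by_cases hk : k ∈ E
          · rw [spreadMatrix_of_sqrt_ne]
            · simp
            · rw [sqrt_sqrt_eq_iff.2 hk]
              exact fun h' => hi (Finset.mem_Ico.2 (Nat.eq_sqrt.1 h'.symm))
          · rw [hx' k hk, mul_zero]
    funext k
    rw [← hx k k.2, hv0, inner_zero_right]
    rfl
  have hfin := LinearMap.finrank_le_finrank_of_injective hT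
  simp only [Module.finrank_fintype_fun_eq_card, Fintype.card_coe] at hfin
  rw [Finset.card_disjSum, hGcard] at hfin
  have := Finset.card_filter_add_card_filter_not (s := E) (fun k => Sum.inl k ∈ J)
  omega

/-- No total subfamily dominates `ℓ²`. -/
theorem false_of_total_of_lower_bound (h : IsGraphSystem 𝕜 spreadMatrix x g y)
    (J : Set (ℕ ⊕ ℕ)) (htotal : ∀ v, (∀ j ∈ J, inner 𝕜 (Sum.elim x g j) v = 0) → v = 0)
    (δ : ℝ) (hδ : 0 < δ) (hlower : ∀ s : Finset (ℕ ⊕ ℕ), (↑s ⊆ J) → ∀ a : ℕ ⊕ ℕ → 𝕜,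
      δ * ∑ j ∈ s, ‖a j‖ ^ 2 ≤ ‖∑ j ∈ s, a j • Sum.elim x g j‖ ^ 2) : False := by
  classical
  -- In units of `2 * n + 1`: the missing coefficients carry at most 4, and `11` beats the upper
  -- bound `10` of `hup`.
  obtain ⟨n, hn, hn1⟩ := ((tendsto_blockHarmonic.eventually_ge_atTop (4 + 11 / δ)).and
    (eventually_ge_atTop 1)).exists
  have hcard := h.card_missing_le J htotal n
  have hcol := le_sum_colSum_sq hn1
  rw [← sum_colSum_spreadMatrix_sq] at hcol
  have hbd : ∀ k ∈ Finset.Ico (n * n * (n * n)) ((n + 1) * (n + 1) * ((n + 1) * (n + 1))),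
      (∑ i ∈ Finset.Ico (n * n) ((n + 1) * (n + 1)), spreadMatrix i k) ^ 2 ≤ 4 := fun k hk =>
    colSum_spreadMatrix_sq_le (Finset.mem_Ico.1 hk).1
  set E := Finset.Ico (n * n * (n * n)) ((n + 1) * (n + 1) * ((n + 1) * (n + 1))) with hE
  set G := Finset.Ico (n * n) ((n + 1) * (n + 1)) with hG
  have hGcard : G.card = 2 * n + 1 := by
    have : (n + 1) * (n + 1) = n * n + (2 * n + 1) := by ring
    rw [hG, Nat.card_Ico]
    omega
  set α : ℕ → ℝ := fun k => ∑ i ∈ G, spreadMatrix i k with hα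
  have hg : ∀ i ∈ G, g i = ∑ k ∈ E, (spreadMatrix i k : 𝕜) • x k := by
    intro i hi
    have his : n = i.sqrt := Nat.eq_sqrt.2 (Finset.mem_Ico.1 hi)
    have hzero : ∀ k, k ∉ E → spreadMatrix i k = 0 := fun k hk =>
      spreadMatrix_of_sqrt_ne fun h' => hk (sqrt_sqrt_eq_iff.1 (by rw [his, h']))
    rw [h.relation i ((n + 1) * (n + 1) * ((n + 1) * (n + 1))) fun k hk =>
      hzero k fun h' => by have := (Finset.mem_Ico.1 h').2; omega]
    refine (Finset.sum_subset ?_ fun k _ hk => by rw [hzero k hk]; simp).symm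
    intro k hk
    exact Finset.mem_range.2 (Finset.mem_Ico.1 hk).2
  have hbessel_x : ∀ s : Finset ℕ, ‖∑ k ∈ s, (α k : 𝕜) • x k‖ ^ 2 ≤ ∑ k ∈ s, α k ^ 2 := by
    intro s
    simpa [Finset.sum_disjSum] using
      h.norm_sum_smul_sq_le (s.disjSum ∅) (Sum.elim (fun k => (α k : 𝕜)) 0)
  have hbessel_g : ‖∑ i ∈ G, g i‖ ^ 2 ≤ 2 * n + 1 := by
    have := h.norm_sum_smul_sq_le ((∅ : Finset ℕ).disjSum G) (fun _ => 1)
    simpa [Finset.sum_disjSum, hGcard] using this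
  have hsum : ∑ k ∈ E, (α k : 𝕜) • x k = ∑ i ∈ G, g i := by
    rw [Finset.sum_congr rfl hg, Finset.sum_comm]
    refine Finset.sum_congr rfl fun k _ => ?_
    rw [hα, ← Finset.sum_smul]
    push_cast
    rfl
  set A := E.filter fun k => Sum.inl k ∈ J with hA
  set M := E.filter fun k => Sum.inl k ∉ J with hM
  have hsplit : ∑ k ∈ A, (α k : 𝕜) • x k + ∑ k ∈ M, (α k : 𝕜) • x k = ∑ i ∈ G, g i := by
    rw [← hsum]; exact Finset.sum_filter_add_sum_filter_not E _ _
  have hsplit2 : ∑ k ∈ A, α k ^ 2 + ∑ k ∈ M, α k ^ 2 = ∑ k ∈ E, α k ^ 2 :=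
    Finset.sum_filter_add_sum_filter_not E _ _
  have hMle : ∑ k ∈ M, α k ^ 2 ≤ 4 * (2 * n + 1) := by
    have h1 : ∑ k ∈ M, α k ^ 2 ≤ M.card • (4 : ℝ) :=
      Finset.sum_le_card_nsmul M _ 4 fun k hk => hbd k (Finset.mem_filter.1 hk).1
    have h2 : (M.card : ℝ) ≤ 2 * n + 1 := by exact_mod_cast hcard
    rw [nsmul_eq_mul] at h1
    linarith
  have hlow : δ * ∑ k ∈ A, α k ^ 2 ≤ ‖∑ k ∈ A, (α k : 𝕜) • x k‖ ^ 2 := by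
    have := hlower (A.disjSum ∅) (by
      intro j hj
      rcases j with k | i
      · exact (Finset.mem_filter.1 (Finset.inl_mem_disjSum.1 (Finset.mem_coe.1 hj))).2
      · simp at hj) (Sum.elim (fun k => (α k : 𝕜)) 0)
    simpa [Finset.sum_disjSum] using this
  -- By `‖u - v‖² ≤ 2‖u‖² + 2‖v‖²`, the constant is `10 = 2 * 1 + 2 * 4`.
  have hup : ‖∑ k ∈ A, (α k : 𝕜) • x k‖ ^ 2 ≤ 10 * (2 * n + 1) := by
    rw [eq_sub_of_add_eq hsplit]
    have h1 := norm_sub_le (∑ i ∈ G, g i) (∑ k ∈ M, (α k : 𝕜) • x k)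
    have h2 := pow_le_pow_left₀ (norm_nonneg _) h1 2
    have h3 := hbessel_x M
    nlinarith [sq_nonneg (‖∑ i ∈ G, g i‖ - ‖∑ k ∈ M, (α k : 𝕜) • x k‖)]
  have hd : (0 : ℝ) < 2 * n + 1 := by positivity
  have hA' : (2 * n + 1) * (11 / δ) ≤ ∑ k ∈ A, α k ^ 2 := by nlinarith
  have h1 := mul_le_mul_of_nonneg_left hA' hδ.le
  have h2 : δ * ((2 * n + 1) * (11 / δ)) = 11 * (2 * n + 1) := by field_simp
  linarith

end IsGraphSystem

/-! ### Normalization, reindexing by `ℕ` and conclusion. -/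

theorem proposition5p3 {𝕜 H : Type*} [RCLike 𝕜] [NormedAddCommGroup H]
    [InnerProductSpace 𝕜 H] [CompleteSpace H] [TopologicalSpace.SeparableSpace H]
    (hinf : ¬ FiniteDimensional 𝕜 H) :
    ∃ f : ℕ → H,
      (∀ i, ‖f i‖ = 1) ∧
      IsHilbertFrame 𝕜 f ∧
      (∃ (σ : ℕ → ℕ) (b : SchauderBasis 𝕜 H), StrictMono σ ∧ ∀ n, b n = f (σ n)) ∧
      (∀ J : Set ℕ, ¬ IsRieszBasis 𝕜 (fun j : J => f j)) ∧
      (∀ J : Set ℕ, ¬ ∃ b : UnconditionalSchauderBasis J 𝕜 H, ∀ j : J, b j = f j) := by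
  obtain ⟨x, g, y, h⟩ := exists_isGraphSystem 𝕜 H hinf spreadMatrix _ _
    spreadMatrix_row_finite spreadMatrix_col_finite
  let q := Equiv.natSumNatEquivNat
  set z := Sum.elim x g with hz
  let u : ℕ ⊕ ℕ → H := fun j => ((‖z j‖⁻¹ : ℝ) : 𝕜) • z j
  let f : ℕ → H := fun n => u (q.symm n)
  have hzpos : ∀ j, 0 < ‖z j‖ := fun j => by linarith [h.half_le_norm j]
  have hf1 : ∀ i, ‖f i‖ = 1 := fun i => by
    simp [f, u, norm_smul, (hzpos _).ne']
  have hzf : ∀ j, z j = ((‖z j‖ : ℝ) : 𝕜) • f (q j) := fun j => by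
    have : ((‖z j‖ : ℝ) : 𝕜) ≠ 0 := RCLike.ofReal_ne_zero.2 (hzpos j).ne'
    simp [f, u, smul_smul, this]
  have hno : ∀ J : Set ℕ, (Submodule.span 𝕜 (Set.range fun j : J => f j)).topologicalClosure = ⊤ →
      ∀ δ : ℝ, 0 < δ → (∀ (s : Finset J) (a : J → 𝕜),
        δ * ∑ j ∈ s, ‖a j‖ ^ 2 ≤ ‖∑ j ∈ s, a j • f j‖ ^ 2) → False := by
    intro J hspan δ hδ hlow
    -- Undoing the normalization costs `‖z j‖² ≥ 1 / 4`.
    refine h.false_of_total_of_lower_bound (q ⁻¹' J) ?_ (δ / 4) (by positivity) ?_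
    · intro v hv
      rw [Submodule.topologicalClosure_eq_top_iff] at hspan
      rw [← Submodule.mem_bot 𝕜, ← hspan, Submodule.mem_orthogonal]
      intro w hw
      induction hw using Submodule.span_induction with
      | mem w hw =>
        obtain ⟨j, rfl⟩ := hw
        have := hv (q.symm j) (by simp)
        simp only [f, u, inner_smul_left]
        rw [hz, this, mul_zero]
      | zero => simp
      | add w w' _ _ hw hw' => rw [inner_add_left, hw, hw', add_zero]
      | smul c w _ hw => rw [inner_smul_left, hw, mul_zero]
    · intro s hs a
      let t : Finset J := s.attach.map
        ⟨fun j : s => (⟨q j, hs j.2⟩ : J), fun i j hij =>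
          Subtype.ext (q.injective (congrArg Subtype.val hij))⟩
      have := hlow t (fun j => a (q.symm j) * ((‖z (q.symm j)‖ : ℝ) : 𝕜))
      have h1 : ∑ j ∈ t, ‖a (q.symm j) * ((‖z (q.symm j)‖ : ℝ) : 𝕜)‖ ^ 2 =
          ∑ j ∈ s, ‖a j * ((‖z j‖ : ℝ) : 𝕜)‖ ^ 2 := by
        rw [← Finset.sum_attach s, Finset.sum_map]
        refine Finset.sum_congr rfl fun j _ => ?_
        change ‖a (q.symm (q j)) * ((‖z (q.symm (q j))‖ : ℝ) : 𝕜)‖ ^ 2 = _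
        rw [q.symm_apply_apply]
      have h2 : ∑ j ∈ t, (a (q.symm j) * ((‖z (q.symm j)‖ : ℝ) : 𝕜)) • f j =
          ∑ j ∈ s, a j • z j := by
        rw [← Finset.sum_attach s, Finset.sum_map]
        refine Finset.sum_congr rfl fun j _ => ?_
        change (a (q.symm (q j)) * ((‖z (q.symm (q j))‖ : ℝ) : 𝕜)) • f (q j) = a j • z j
        rw [q.symm_apply_apply, mul_smul, ← hzf]
      rw [h1, h2] at this
      refine le_trans ?_ this
      rw [div_mul_eq_mul_div, mul_div_assoc]
      refine mul_le_mul_of_nonneg_left ?_ hδ.le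
      rw [Finset.sum_div]
      refine Finset.sum_le_sum fun j _ => ?_
      have h1 : 1 / 2 ≤ ‖z j‖ := h.half_le_norm j
      rw [norm_mul, RCLike.norm_ofReal, abs_norm, mul_pow]
      nlinarith [sq_nonneg ‖a j‖, mul_le_mul_of_nonneg_left
        (by nlinarith : 1 / 4 ≤ ‖z j‖ ^ 2) (sq_nonneg ‖a j‖)]
  refine ⟨f, hf1, ?_, ?_, ?_, ?_⟩
  · obtain ⟨A, B, hA, hAB⟩ := h.isHilbertFrame_normalized
    refine ⟨A, B, hA, fun v => ?_⟩
    obtain ⟨hs, hl, hu⟩ := hAB v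
    have htsum := q.symm.tsum_eq fun j => ‖inner 𝕜 v (u j)‖ ^ 2
    refine ⟨(q.symm.summable_iff (f := fun j => ‖inner 𝕜 v (u j)‖ ^ 2)).2 hs, ?_, ?_⟩
    · exact hl.trans htsum.ge
    · exact htsum.le.trans hu
  · obtain ⟨b, hb⟩ := h.exists_schauderBasis
    -- The vectors `x n` sit at the even positions `2 * n`, in order.
    refine ⟨fun n => q (Sum.inl n), b, ?_, fun n => ?_⟩
    · intro m n hmn
      simp only [q, Equiv.natSumNatEquivNat_apply, Sum.elim_inl]
      omega
    · rw [hb n]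
      simp [f, u, hz]
  · rintro J ⟨hspan, M, hM, hR⟩
    refine hno J hspan (M⁻¹ ^ 2) (by positivity) fun s a => ?_
    have := pow_le_pow_left₀ (by positivity) (hR s a).1 2
    rwa [mul_pow, Real.sq_sqrt (by positivity)] at this
  · rintro J ⟨b, hb⟩
    have hb' : b.basis = fun j : J => f j := funext hb
    obtain ⟨δ, hδ, hlow⟩ := UnconditionalSchauderBasis.exists_lower_bound b
      fun j => by rw [hb j, hf1]
    refine hno J ?_ δ hδ fun s a => ?_
    · rw [← hb']; exact UnconditionalSchauderBasis.topologicalClosure_span b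
    · simpa [hb'] using hlow s a
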